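/- Let $\mathcal{G}=(I,\Theta,\pi,(A_i,u_i)_{i\in I})$ be a base game: $I$ is a finite set of players, $\Theta$ a finite set of payoff states, $\pi\in\Delta(\Theta)$ a prior with full support, and each player $i$ has a finite nonempty action set $A_i$ and a utility function $u_i:A\times\Theta\to\mathbb{R}$, where $A=\prod_{j\in I}A_j$. Write $A_{-i}=\prod_{j\ne i}A_j$. An outcome is a probability distribution $p$ on $A\times\Theta$ whose marginal on $\Theta$ is $\pi$. It is obedient, i.e. a Bayes correlated equilibrium (BCE), if for all $i\in I$ and $a_i,b_i\in A_i$, $$\sum_{a_{-i},\theta}\bigl(u_i(a_i,a_{-i},\theta)-u_i(b_i,a_{-i},\theta)\bigr)\,p(a_i,a_{-i},\theta)\ \ge\ 0.$$ Let $p(a_i)=\sum_{a_{-i},\theta}p(a_i,a_{-i},\theta)$, let $\mathrm{supp}_i(p)=\{a_i\in A_i: p(a_i)>0\}$, and for $a_i\in\mathrm{supp}_i(p)$ let $p_{a_i}\in\Delta(A_{-i}\times\Theta)$ be the conditional distribution $p_{a_i}(a_{-i},\theta)=p(a_i,a_{-i},\theta)/p(a_i)$. Put $BR(p_{a_i})=\arg\max_{b_i\in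 A_i}\sum_{a_{-i},\theta}u_i(b_i,a_{-i},\theta)\,p_{a_i}(a_{-i},\theta)$. A BCE $p$ is separated if for all $i\in I$ and $a_i,b_i\in\mathrm{supp}_i(p)$, $p_{a_i}\neq p_{b_i}$ implies $BR(p_{a_i})\cap BR(p_{b_i})=\varnothing$. Then: 1. $\mathcal{G}$ admits a separated BCE. 2. Let $\alpha=(\alpha_i)_{i\in I}$ be any (possibly mixed) Nash equilibrium of the complete-information game with players $I$, action sets $A_i$ and payoffs $a\mapsto\sum_{\theta}u_i(a,\theta)\pi(\theta)$. Then the outcome $p(a,\theta)=\pi(\theta)\prod_{i\in I}\alpha_i(a_i)$ is a separated BCE, and in fact $p_{a_i}=p_{b_i}$ for all $i\in I$ and $a_i,b_i\in\mathrm{supp}_i(p)$, so that the separation condition holds trivially. -/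

import Mathlib

/-- A base game with players `I`, payoff states `Θ` and action sets `A i` (all finite in use):
a full-support prior on `Θ` and, for each player, a utility on action profiles and states. -/
structure BaseGame (I Θ : Type*) (A : I → Type*) [Fintype Θ] where
  /-- the prior distribution of the payoff state -/
  prior : Θ → ℝ
  prior_mem : prior ∈ stdSimplex ℝ Θ
  prior_pos : ∀ θ, 0 < prior θ
  /-- the utility functions -/
  u : ∀ _ : I, (∀ j, A j) → Θ → ℝ

/-- Action profiles of the players other than `i`. -/
abbrev OthersProfile {I : Type*} (A : I → Type*) (i : I) : Type _ :=
  ∀ j : {j : I // j ≠ i}, A j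

/-- The profile `(a_i, a_{-i})`. -/
def joinProfile {I : Type*} [DecidableEq I] {A : I → Type*} (i : I) (x : A i)
    (y : OthersProfile A i) : ∀ j, A j :=
  (Equiv.piSplitAt i A).symm (x, y)

/-- Expected payoff of the mixed-strategy profile `α` under the payoff function `w` on pure
action profiles. -/
def mixedPayoff {I : Type*} {A : I → Type*} [Fintype I] [DecidableEq I] [∀ i, Fintype (A i)]
    (w : (∀ j, A j) → ℝ) (α : ∀ i, A i → ℝ) : ℝ :=
  ∑ a : ∀ j, A j, (∏ j, α j (a j)) * w a

/-- `α` is a (mixed-strategy) Nash equilibrium of the finite complete-information game in which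
player `i` has payoff function `w i`. -/
def IsNashEquilibrium {I : Type*} {A : I → Type*} [Fintype I] [DecidableEq I]
    [∀ i, Fintype (A i)] (w : ∀ _ : I, (∀ j, A j) → ℝ) (α : ∀ i, A i → ℝ) : Prop :=
  (∀ i, α i ∈ stdSimplex ℝ (A i)) ∧
    ∀ i, ∀ β ∈ stdSimplex ℝ (A i),
      mixedPayoff (w i) (Function.update α i β) ≤ mixedPayoff (w i) α

/-- The marginal probability of player `i` taking action `x` under `p`. -/
def actionProb {I Θ : Type*} {A : I → Type*} [Fintype I] [DecidableEq I] [Fintype Θ]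
    [∀ i, Fintype (A i)] (p : (∀ j, A j) × Θ → ℝ) (i : I) (x : A i) : ℝ :=
  ∑ y : OthersProfile A i, ∑ θ, p (joinProfile i x y, θ)

/-- The set of player `i`'s actions that have positive probability under `p`. -/
def actionSupp {I Θ : Type*} {A : I → Type*} [Fintype I] [DecidableEq I] [Fintype Θ]
    [∀ i, Fintype (A i)] (p : (∀ j, A j) × Θ → ℝ) (i : I) : Set (A i) :=
  {x | 0 < actionProb p i x}

/-- The conditional distribution of the others' actions and the state, given that player `i`
takes action `x` (used only for `x` of positive probability). -/
noncomputable def condBelief {I Θ : Type*} {A : I → Type*} [Fintype I] [DecidableEq I]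
    [Fintype Θ] [∀ i, Fintype (A i)] (p : (∀ j, A j) × Θ → ℝ) (i : I) (x : A i) :
    OthersProfile A i × Θ → ℝ :=
  fun yθ => p (joinProfile i x yθ.1, yθ.2) / actionProb p i x

namespace BaseGame

/-- `p` is an outcome: a probability distribution on action profiles and states whose marginal
on states is the prior. -/
def IsOutcome {I Θ : Type*} {A : I → Type*} [Fintype I] [DecidableEq I] [Fintype Θ]
    [∀ i, Fintype (A i)] (G : BaseGame I Θ A) (p : (∀ j, A j) × Θ → ℝ) : Prop :=
  p ∈ stdSimplex ℝ ((∀ j, A j) × Θ) ∧ ∀ θ, ∑ a, p (a, θ) = G.prior θ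

/-- The obedience constraint. -/
def Obedient {I Θ : Type*} {A : I → Type*} [Fintype I] [DecidableEq I] [Fintype Θ]
    [∀ i, Fintype (A i)] (G : BaseGame I Θ A) (p : (∀ j, A j) × Θ → ℝ) : Prop :=
  ∀ (i : I) (x x' : A i),
    0 ≤ ∑ y : OthersProfile A i, ∑ θ,
      (G.u i (joinProfile i x y) θ - G.u i (joinProfile i x' y) θ) * p (joinProfile i x y, θ)

/-- A Bayes correlated equilibrium is an obedient outcome. -/
def IsBCE {I Θ : Type*} {A : I → Type*} [Fintype I] [DecidableEq I] [Fintype Θ]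
    [∀ i, Fintype (A i)] (G : BaseGame I Θ A) (p : (∀ j, A j) × Θ → ℝ) : Prop :=
  G.IsOutcome p ∧ G.Obedient p

/-- Player `i`'s expected utility from action `x` under belief `q` on the others' actions and
the state. -/
def beliefPayoff {I Θ : Type*} {A : I → Type*} [Fintype I] [DecidableEq I] [Fintype Θ]
    [∀ i, Fintype (A i)] (G : BaseGame I Θ A) (i : I) (q : OthersProfile A i × Θ → ℝ)
    (x : A i) : ℝ :=
  ∑ y : OthersProfile A i, ∑ θ, G.u i (joinProfile i x y) θ * q (y, θ)

/-- Player `i`'s set of best responses to the belief `q`. -/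
def bestResponses {I Θ : Type*} {A : I → Type*} [Fintype I] [DecidableEq I] [Fintype Θ]
    [∀ i, Fintype (A i)] (G : BaseGame I Θ A) (i : I) (q : OthersProfile A i × Θ → ℝ) :
    Set (A i) :=
  {x | ∀ x', G.beliefPayoff i q x' ≤ G.beliefPayoff i q x}

/-- The separation constraint: distinct conditional beliefs have disjoint best responses. -/
def Separated {I Θ : Type*} {A : I → Type*} [Fintype I] [DecidableEq I] [Fintype Θ]
    [∀ i, Fintype (A i)] (G : BaseGame I Θ A) (p : (∀ j, A j) × Θ → ℝ) : Prop :=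
  ∀ i, ∀ x ∈ actionSupp p i, ∀ x' ∈ actionSupp p i, condBelief p i x ≠ condBelief p i x' →
    G.bestResponses i (condBelief p i x) ∩ G.bestResponses i (condBelief p i x') = ∅

/-- A separated BCE. -/
def IsSeparatedBCE {I Θ : Type*} {A : I → Type*} [Fintype I] [DecidableEq I] [Fintype Θ]
    [∀ i, Fintype (A i)] (G : BaseGame I Θ A) (p : (∀ j, A j) × Θ → ℝ) : Prop :=
  G.IsBCE p ∧ G.Separated p

/-- Payoffs of the prior-averaged complete-information game. -/
def averagedPayoff {I Θ : Type*} {A : I → Type*} [Fintype Θ] (G : BaseGame I Θ A) (i : I)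
    (a : ∀ j, A j) : ℝ :=
  ∑ θ, G.u i a θ * G.prior θ

/-- The joint distribution of actions and state when the players independently follow the mixed
strategies `α`, irrespective of the state. -/
def inducedOutcome {I Θ : Type*} {A : I → Type*} [Fintype I] [Fintype Θ]
    (G : BaseGame I Θ A) (α : ∀ i, A i → ℝ) : (∀ j, A j) × Θ → ℝ :=
  fun aθ => G.prior aθ.2 * ∏ j, α j (aθ.1 j)

end BaseGame

/-! When the players mix independently of each other and of the state, an action carries no
information: conditioning on any action of positive probability cancels the factor `α i x`, and the
belief left over depends only on `i`. So all conditional beliefs of a player agree and separation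
has nothing to check. Obedience reduces to the Nash property, because utilities averaged over the
prior are exactly the payoffs of the complete-information game.

Existence therefore rests on Nash's theorem, proved here from the ground up. A parity argument gives
Scarf's lemma (`exists_isDominant_colourful`). Applied to a fine grid, it yields points of different
colours close together (`exists_colourful_grid_points`); colouring a point by a coordinate that `F`
does not decrease then gives Brouwer on a simplex (`exists_fixedPoint_stdSimplex`). Nash's map is
transported from the product of strategy simplices to a single simplex, where Brouwer applies. -/

/-! ### Dominant sets and Scarf's lemma -/

/-- A finite set `S` is dominant for a family of rankings `f i` if no element is ranked strictly
above some member of `S` in every ranking simultaneously. -/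
def IsDominant {ι X L : Type*} [LinearOrder L] (f : ι → X → L) (S : Finset X) : Prop :=
  ∀ y, ∃ i, ∀ x ∈ S, f i y ≤ f i x

/-- `y` is the `i`-maximal element among those lying above `m k` in every ranking `k ≠ i`. -/
def IsReplacement {ι X L : Type*} [LinearOrder L] (f : ι → X → L) (m : ι → X) (i : ι) (y : X) :
    Prop :=
  (∀ k, k ≠ i → f k (m k) < f k y) ∧ ∀ z, (∀ k, k ≠ i → f k (m k) < f k z) → f i z ≤ f i y

section Scarf

variable {ι X L : Type*} [LinearOrder L] {f : ι → X → L}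

theorem IsDominant.mono {S R : Finset X} (hS : IsDominant f S) (h : R ⊆ S) : IsDominant f R :=
  fun y => (hS y).imp fun _ hi x hx => hi x (h hx)

/-- In a dominant set of full size, every ranking has its minimum at its own element. -/
theorem IsDominant.exists_index [Fintype ι] [DecidableEq ι] (hf : ∀ i, Function.Injective (f i)) {S : Finset X}
    (hS : IsDominant f S) (hc : S.card = Fintype.card ι) :
    ∃ κ : X → ι, (∀ x ∈ S, ∀ x' ∈ S, f (κ x) x ≤ f (κ x) x') ∧ ∀ i, ∃ x ∈ S, κ x = i := by
  choose κ hκ using hS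
  refine ⟨κ, fun x _ => hκ x, fun i => ?_⟩
  have hinj : Set.InjOn κ S := by
    intro x hx x' hx' h
    refine hf (κ x) (le_antisymm (hκ x x' hx') ?_)
    rw [h]
    exact hκ x' x hx
  have himg : S.image κ = Finset.univ := by
    apply Finset.eq_univ_of_card
    rw [Finset.card_image_of_injOn hinj, hc]
  have : i ∈ S.image κ := himg ▸ Finset.mem_univ i
  simpa using this

theorem exists_isReplacement [Finite X] {m : ι → X} {i : ι}
    (h : ∃ y, ∀ k, k ≠ i → f k (m k) < f k y) :
    ∃ y, IsReplacement f m i y := by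
  classical
  cases nonempty_fintype X
  obtain ⟨y0, hy0⟩ := h
  obtain ⟨y, hy, hmax⟩ := Finset.exists_max_image
    (Finset.univ.filter fun y => ∀ k, k ≠ i → f k (m k) < f k y) (f i) ⟨y0, by simpa using hy0⟩
  refine ⟨y, by simpa using hy, fun z hz => hmax z (by simpa using hz)⟩

theorem IsReplacement.eq (hf : ∀ i, Function.Injective (f i)) {m : ι → X} {i : ι} {y y' : X}
    (h : IsReplacement f m i y) (h' : IsReplacement f m i y') : y = y' :=
  hf i (le_antisymm (h'.2 _ h.1) (h.2 _ h'.1))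

/-- The two ways to complete a dominant set that lacks one element. -/
theorem IsDominant.exists_pair [Fintype ι] [DecidableEq ι] [DecidableEq X]
    (hf : ∀ i, Function.Injective (f i)) {R : Finset X}
    (hR : IsDominant f R) (hne : R.Nonempty) (hc : R.card + 1 = Fintype.card ι) :
    ∃ (m : ι → X) (i j : ι), i ≠ j ∧ (∀ k, m k ∈ R ∧ ∀ x ∈ R, f k (m k) ≤ f k x) ∧
      (∀ y, (y ∉ R ∧ IsDominant f (insert y R)) ↔ IsReplacement f m i y ∨ IsReplacement f m j y) ∧
      ∀ y, ¬ (IsReplacement f m i y ∧ IsReplacement f m j y) := by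
  have hm : ∀ k, ∃ x, x ∈ R ∧ ∀ x' ∈ R, f k x ≤ f k x' := fun k => by
    obtain ⟨x, hx, h⟩ := Finset.exists_min_image R (f k) hne
    exact ⟨x, hx, h⟩
  choose m hmR hmin using hm
  have hmeq : ∀ k x, x ∈ R → (∀ x' ∈ R, f k x ≤ f k x') → x = m k := fun k x hx h =>
    hf k (le_antisymm (h _ (hmR k)) (hmin k x hx))
  -- `R` has one element fewer than there are rankings, so two rankings share a minimum. Only these
  -- two can give up their minimum to a new element.
  obtain ⟨i, -, j, -, hij, hmij⟩ := Finset.exists_ne_map_eq_of_card_lt_of_maps_to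
    (s := (Finset.univ : Finset ι)) (t := R) (f := m)
    (by rw [Finset.card_univ]; omega) (fun k _ => hmR k)
  have hsuff : ∀ i j, i ≠ j → m i = m j → ∀ y, IsReplacement f m i y →
      y ∉ R ∧ IsDominant f (insert y R) := by
    intro i j hij hmij y hy
    constructor
    · intro hyR
      obtain ⟨k, hk⟩ := hR y
      have hyk : y = m k := hmeq k y hyR hk
      by_cases hki : k = i
      · subst hki
        have := hy.1 j hij.symm
        rw [hyk, hmij] at this
        exact lt_irrefl _ this
      · have := hy.1 k hki
        rw [← hyk] at this
        exact lt_irrefl _ this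
    · intro z
      by_cases hz : ∀ k, k ≠ i → f k (m k) < f k z
      -- `y` lies strictly above `m k` for every `k ≠ i`, so dominance of `R` at `y` can only be
      -- witnessed by `i`: `y` is `i`-below all of `R`.
      · refine ⟨i, fun x hx => (hy.2 z hz).trans ?_⟩
        rcases Finset.mem_insert.1 hx with rfl | hx
        · exact le_rfl
        · obtain ⟨k, hk⟩ := hR y
          by_cases hki : k = i
          · exact hki ▸ hk x (by simpa using hx)
          · exact absurd (hy.1 k hki) (not_lt.2 (hk _ (hmR k)))
      · push Not at hz
        obtain ⟨k, hki, hk⟩ := hz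
        refine ⟨k, fun x hx => hk.trans ?_⟩
        rcases Finset.mem_insert.1 hx with rfl | hx
        · exact (hy.1 k hki).le
        · exact hmin k x hx
  refine ⟨m, i, j, hij, fun k => ⟨hmR k, hmin k⟩, fun y => ⟨?_, ?_⟩, ?_⟩
  · rintro ⟨hy, hd⟩
    obtain ⟨κ, hκ, hsurj⟩ := hd.exists_index hf (by rw [Finset.card_insert_of_notMem hy, hc])
    have hother : ∀ l, l ≠ κ y → κ (m l) = l ∧ f l (m l) < f l y := by
      intro l hl
      obtain ⟨x, hx, rfl⟩ := hsurj l
      rcases Finset.mem_insert.1 hx with rfl | hxR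
      · exact absurd rfl hl
      · have hxm := hmeq (κ x) x hxR fun x' hx' => hκ x hx x' (Finset.mem_insert_of_mem hx')
        rw [← hxm]
        refine ⟨rfl, lt_of_le_of_ne (hκ x hx y (Finset.mem_insert_self _ _)) fun h => hy ?_⟩
        exact hf _ h ▸ hxR
    have hrep : IsReplacement f m (κ y) y := by
      refine ⟨fun k hk => (hother k hk).2, fun z hz => ?_⟩
      obtain ⟨l, hl⟩ := hd z
      by_cases hlk : l = κ y
      · exact hlk ▸ hl y (Finset.mem_insert_self _ _)
      · exact absurd (hz l hlk) (not_lt.2 (hl _ (Finset.mem_insert_of_mem (hmR l))))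
    by_cases h1 : i = κ y
    · exact Or.inl (h1 ▸ hrep)
    by_cases h2 : j = κ y
    · exact Or.inr (h2 ▸ hrep)
    -- If `y` took over neither `i` nor `j`, the common minimum `m i = m j` would have both indices
    -- under `κ`.
    exact absurd ((hother i h1).1.symm.trans ((congrArg κ hmij).trans (hother j h2).1)) hij
  · rintro (h | h)
    · exact hsuff i j hij hmij y h
    · exact hsuff j i hij.symm hmij.symm y h
  · rintro y ⟨h1, h2⟩
    obtain ⟨k, hk⟩ := hR y
    by_cases hki : k = i
    · exact absurd (h2.1 k (hki ▸ hij)) (not_lt.2 (hk _ (hmR k)))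
    · exact absurd (h1.1 k hki) (not_lt.2 (hk _ (hmR k)))

/-- Removing one element so that all colours but `i₀` remain can be done in an even number of ways
when `S` does not carry all colours. -/
theorem even_card_colour_omissions [Fintype ι] [DecidableEq ι] [DecidableEq X] {c : X → ι} {i₀ : ι} {S : Finset X}
    (hS : S.card = Fintype.card ι) (hcol : S.image c ≠ Finset.univ) :
    Even (S.filter fun x => (S.erase x).image c = Finset.univ.erase i₀).card := by
  rcases (S.filter fun x => (S.erase x).image c = Finset.univ.erase i₀).eq_empty_or_nonempty
    with h | ⟨x, hx⟩
  · simp [h]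
  obtain ⟨hxS, hx⟩ := Finset.mem_filter.1 hx
  have hSx : S.image c = insert (c x) (Finset.univ.erase i₀) := by
    rw [← hx, ← Finset.image_insert, Finset.insert_erase hxS]
  have hcx : c x ≠ i₀ := by
    intro h
    apply hcol
    rw [hSx, h, Finset.insert_erase (Finset.mem_univ _)]
  -- The colour of `x` survives its removal, so some `x'` repeats it. By counting it is the only
  -- repetition, and exactly `x` and `x'` are removable.
  have hcx' : c x ∈ (S.erase x).image c := by rw [hx]; simp [hcx]
  obtain ⟨x', hx', hcxx⟩ := Finset.mem_image.1 hcx'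
  obtain ⟨hne, hx'S⟩ := Finset.mem_erase.1 hx'
  have hinj : ∀ z ∈ S, (S.erase z).image c = Finset.univ.erase i₀ →
      Set.InjOn c (S.erase z : Finset X) := by
    intro z hz h
    apply Finset.injOn_of_card_image_eq
    rw [h, Finset.card_erase_of_mem hz, Finset.card_erase_of_mem (Finset.mem_univ _), hS,
      Finset.card_univ]
  have : (S.filter fun x => (S.erase x).image c = Finset.univ.erase i₀) = {x, x'} := by
    ext z
    simp only [Finset.mem_filter, Finset.mem_insert, Finset.mem_singleton]
    constructor
    · rintro ⟨hz, h⟩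
      by_contra hzz
      push Not at hzz
      exact hne (hinj z hz h (by simp [hx'S, hzz.2.symm]) (by simp [hxS, hzz.1.symm]) hcxx)
    · rintro (rfl | rfl)
      · exact ⟨hxS, hx⟩
      · refine ⟨hx'S, ?_⟩
        rw [← hx]
        ext i
        simp only [Finset.mem_image, Finset.mem_erase]
        constructor
        · rintro ⟨w, ⟨hw, hwS⟩, rfl⟩
          by_cases hwx : w = x
          · exact ⟨z, ⟨hne, hx'S⟩, by rw [hwx, hcxx]⟩
          · exact ⟨w, ⟨hwx, hwS⟩, rfl⟩
        · rintro ⟨w, ⟨hw, hwS⟩, rfl⟩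
          by_cases hwx : w = z
          · exact ⟨x, ⟨hne.symm, hxS⟩, by rw [hwx, hcxx]⟩
          · exact ⟨w, ⟨hwx, hwS⟩, rfl⟩
  rw [this, Finset.card_pair hne.symm]
  exact even_two

end Scarf

/-- Scarf's lemma: among the points of `T` and one slack element per ranking there is a dominant
set that carries every colour. -/
theorem exists_isDominant_colourful {ι T L : Type*} [Fintype ι] [DecidableEq ι] [Nonempty ι]
    [Fintype T] [DecidableEq T] [Nonempty T] [LinearOrder L] {f : ι → T ⊕ ι → L}
    (hf : ∀ i, Function.Injective (f i))
    (hlow : ∀ i t, f i (.inr i) < f i (.inl t))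
    (hhigh : ∀ i j t, i ≠ j → f i (.inl t) < f i (.inr j)) (c : T → ι) :
    ∃ S : Finset (T ⊕ ι), IsDominant f S ∧ S.image (Sum.elim c id) = Finset.univ := by
  classical
  by_contra hno
  push Not at hno
  obtain ⟨i₀⟩ := ‹Nonempty ι›
  set col : T ⊕ ι → ι := Sum.elim c id
  have hpos : 0 < Fintype.card ι := Fintype.card_pos_iff.2 ⟨i₀⟩
  let slack : ι → Finset (T ⊕ ι) := fun k => (Finset.univ.erase k).image Sum.inr
  have hslack : ∀ k, (slack k).card + 1 = Fintype.card ι := fun k => by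
    simp only [slack]
    rw [Finset.card_image_of_injective _ Sum.inr_injective,
      Finset.card_erase_of_mem (Finset.mem_univ _), Finset.card_univ]
    omega
  have hslackcol : ∀ k, (slack k).image col = Finset.univ.erase k := fun k => by
    ext j
    simp [slack, col]
  -- Double counting of pairs (facet, completing element). Grouped by the completed set, the count
  -- is even if no dominant set is colourful; grouped by facet, every fibre is even except that of
  -- `slack i₀`, which is a singleton.
  let Φ : Finset (Finset (T ⊕ ι) × (T ⊕ ι)) := Finset.univ.filter fun q =>
    q.2 ∉ q.1 ∧ q.1.card + 1 = Fintype.card ι ∧ q.1.image col = Finset.univ.erase i₀ ∧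
      IsDominant f (insert q.2 q.1)
  have heven : Even Φ.card := by
    rw [Finset.card_eq_sum_card_fiberwise (f := fun q => insert q.2 q.1)
      (t := (Finset.univ : Finset (Finset (T ⊕ ι)))) (fun _ _ => Finset.mem_univ _)]
    refine Finset.even_sum _ fun S _ => ?_
    by_cases hS : S.card = Fintype.card ι ∧ IsDominant f S
    · have h := even_card_colour_omissions (i₀ := i₀) hS.1 (hno S hS.2)
      refine (congrArg Even ?_).mpr h
      refine Finset.card_bij (fun q _ => q.2) ?_ ?_ ?_
      · rintro ⟨R, x⟩ hq
        simp only [Φ, Finset.mem_filter, Finset.mem_univ, true_and] at hq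
        obtain ⟨⟨h1, h2, h3, h4⟩, rfl⟩ := hq
        simp [Finset.erase_insert h1, h3]
      · rintro ⟨R, x⟩ hq ⟨R', x'⟩ hq' hx
        simp only [Φ, Finset.mem_filter, Finset.mem_univ, true_and] at hq hq' hx
        subst hx
        have := congrArg (fun U => U.erase x) (hq.2.trans hq'.2.symm)
        simp only [Finset.erase_insert hq.1.1, Finset.erase_insert hq'.1.1] at this
        rw [this]
      · intro x hx
        obtain ⟨hxS, hx⟩ := Finset.mem_filter.1 hx
        refine ⟨(S.erase x, x), ?_, rfl⟩
        simp only [Φ, Finset.mem_filter, Finset.mem_univ, true_and]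
        rw [Finset.insert_erase hxS]
        refine ⟨⟨by simp, ?_, hx, hS.2⟩, rfl⟩
        rw [Finset.card_erase_of_mem hxS, hS.1]
        omega
    · rw [Finset.card_eq_zero.2]
      · exact Even.zero
      · rw [Finset.filter_eq_empty_iff]
        rintro ⟨R, x⟩ hq h
        simp only [Φ, Finset.mem_filter, Finset.mem_univ, true_and] at hq h
        exact hS ⟨by rw [← h, Finset.card_insert_of_notMem hq.1, hq.2.1], h ▸ hq.2.2.2⟩
  have hfiber : ∀ R, (Φ.filter fun q => q.1 = R).card =
      (Finset.univ.filter fun y => y ∉ R ∧ R.card + 1 = Fintype.card ι ∧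
        R.image col = Finset.univ.erase i₀ ∧ IsDominant f (insert y R)).card := by
    intro R
    refine Finset.card_bij (fun q _ => q.2) ?_ ?_ ?_
    · rintro ⟨R', x⟩ hq
      simp only [Φ, Finset.mem_filter, Finset.mem_univ, true_and] at hq ⊢
      obtain ⟨h, rfl⟩ := hq
      exact h
    · rintro ⟨R', x⟩ hq ⟨R'', x'⟩ hq' hx
      simp only [Φ, Finset.mem_filter, Finset.mem_univ, true_and] at hq hq' hx
      rw [hx, hq.2, hq'.2]
    · intro x hx
      refine ⟨(R, x), ?_, rfl⟩
      simpa [Φ] using hx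
  have hodd : Odd Φ.card := by
    rw [Finset.card_eq_sum_card_fiberwise (f := fun q => q.1)
      (t := (Finset.univ : Finset (Finset (T ⊕ ι)))) (fun _ _ => Finset.mem_univ _),
      ← Finset.sum_erase_add _ _ (Finset.mem_univ (slack i₀))]
    refine Even.add_odd (Finset.even_sum _ fun R hR => ?_) ?_
    · have hR0 : R ≠ slack i₀ := (Finset.mem_erase.1 hR).1
      rw [hfiber]
      by_cases hRR : R.card + 1 = Fintype.card ι ∧ R.image col = Finset.univ.erase i₀ ∧
          IsDominant f R
      · obtain ⟨hcard, hRcol, hd⟩ := hRR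
        have hne : R.Nonempty := by
          rw [Finset.nonempty_iff_ne_empty]
          rintro rfl
          apply hR0
          have := hslack i₀
          exact (Finset.card_eq_zero.1 (by simp at hcard; omega)).symm
        obtain ⟨m, i, j, hij, hm, hiff, hdisj⟩ := hd.exists_pair hf hne hcard
        -- The slack `inr i` is a candidate: `R` lies in no `slack k`, so it contains a point or
        -- `inr k`, and both rank below `inr i` in every ranking `k ≠ i`.
        have hex : ∀ i, ∃ y, IsReplacement f m i y := fun i => by
          refine exists_isReplacement ⟨.inr i, fun k hki => ?_⟩
          have : ¬ R ⊆ slack k := by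
            intro hsub
            have hEq : R = slack k :=
              Finset.eq_of_subset_of_card_le hsub (by have := hslack k; omega)
            rw [hEq, hslackcol] at hRcol
            have hk : k = i₀ := by
              by_contra hk
              have : k ∈ Finset.univ.erase i₀ := by simp [hk]
              rw [← hRcol] at this
              simp at this
            exact hR0 (hk ▸ hEq)
          obtain ⟨x, hxR, hx⟩ := Finset.not_subset.1 this
          refine ((hm k).2 x hxR).trans_lt ?_
          rcases x with t | l
          · exact hhigh k i t hki
          · have : l = k := by
              by_contra hl
              exact hx (by simp [slack, hl])
            subst this
            obtain ⟨t⟩ := ‹Nonempty T›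
            exact (hlow l t).trans (hhigh l i t hki)
        obtain ⟨y, hy⟩ := hex i
        obtain ⟨y', hy'⟩ := hex j
        have hyy : y ≠ y' := fun h => hdisj y ⟨hy, h ▸ hy'⟩
        have : (Finset.univ.filter fun y => y ∉ R ∧ R.card + 1 = Fintype.card ι ∧
            R.image col = Finset.univ.erase i₀ ∧ IsDominant f (insert y R)) = {y, y'} := by
          ext z
          have hz := hiff z
          simp only [Finset.mem_filter, Finset.mem_univ, true_and, hcard, hRcol,
            Finset.mem_insert, Finset.mem_singleton]
          rw [hz]
          constructor
          · rintro (h | h)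
            · exact Or.inl (h.eq hf hy)
            · exact Or.inr (h.eq hf hy')
          · rintro (rfl | rfl)
            · exact Or.inl hy
            · exact Or.inr hy'
        rw [this, Finset.card_pair hyy]
        exact even_two
      · rw [Finset.card_eq_zero.2]
        · exact Even.zero
        · rw [Finset.filter_eq_empty_iff]
          rintro x - ⟨-, h2, h3, h4⟩
          exact hRR ⟨h2, h3, h4.mono (Finset.subset_insert _ _)⟩
    · rw [hfiber]
      -- The unique completion of the boundary facet `slack i₀` is the `i₀`-highest point.
      obtain ⟨t₀, -, ht₀⟩ := Finset.exists_max_image (Finset.univ : Finset T)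
        (fun t => f i₀ (.inl t)) Finset.univ_nonempty
      have hsub : ∀ y k, k ≠ i₀ → Sum.inr k ∈ insert y (slack i₀) := fun y k hk => by
        simp [slack, hk]
      have : (Finset.univ.filter fun y => y ∉ slack i₀ ∧ (slack i₀).card + 1 = Fintype.card ι ∧
            (slack i₀).image col = Finset.univ.erase i₀ ∧
            IsDominant f (insert y (slack i₀))) = {Sum.inl t₀} := by
        ext y
        simp only [Finset.mem_filter, Finset.mem_univ, true_and, hslack, hslackcol,
          Finset.mem_singleton]
        constructor
        · rintro ⟨hy, hd⟩
          obtain ⟨k, hk⟩ := hd (.inl t₀)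
          have hki : k = i₀ := by
            by_contra hki
            exact absurd (hlow k t₀) (not_lt.2 (hk _ (hsub y k hki)))
          subst hki
          rcases y with t | l
          · exact hf k (le_antisymm (ht₀ t (Finset.mem_univ _))
              (hk _ (Finset.mem_insert_self _ _)))
          · by_cases hl : l = k
            · subst hl
              exact absurd (hlow l t₀) (not_lt.2 (hk _ (Finset.mem_insert_self _ _)))
            · exact absurd (by simp [slack, hl]) hy
        · rintro rfl
          refine ⟨by simp [slack], fun z => ?_⟩
          by_cases hz : ∃ t, z = .inl t ∨ z = .inr i₀
          · refine ⟨i₀, fun x hx => ?_⟩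
            have hz0 : f i₀ z ≤ f i₀ (.inl t₀) := by
              obtain ⟨t, rfl | rfl⟩ := hz
              · exact ht₀ t (Finset.mem_univ _)
              · exact (hlow _ _).le
            rcases Finset.mem_insert.1 hx with rfl | hx
            · exact hz0
            · obtain ⟨k, hk, rfl⟩ := Finset.mem_image.1 hx
              exact hz0.trans (hhigh _ _ _ (Finset.mem_erase.1 hk).1.symm).le
          · rcases z with t | l
            · exact absurd ⟨t, Or.inl rfl⟩ hz
            · have hl : l ≠ i₀ := fun h => hz ⟨t₀, Or.inr (h ▸ rfl)⟩
              refine ⟨l, fun x hx => ?_⟩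
              rcases Finset.mem_insert.1 hx with rfl | hx
              · exact (hlow _ _).le
              · obtain ⟨k, hk, rfl⟩ := Finset.mem_image.1 hx
                by_cases hkl : l = k
                · rw [hkl]
                · exact ((hlow l t₀).trans (hhigh l k t₀ hkl)).le
      rw [this, Finset.card_singleton]
      exact odd_one
  exact (Nat.not_even_iff_odd.2 hodd) heven

/-! ### Brouwer's fixed-point theorem -/

/-- Discrete fixed-point lemma on the grid points of the simplex with denominator `N`. -/
theorem exists_colourful_grid_points {ι : Type*} [Fintype ι] [DecidableEq ι] [Nonempty ι] (N : ℕ)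
    (c : (ι → ℕ) → ι) :
    ∃ (C : Finset ι) (s : ι → ι → ℕ), C.Nonempty ∧ (∀ k ∈ C, ∑ i, s k i = N ∧ c (s k) = k) ∧
      (∀ k ∈ C, ∀ l ∈ C, ∀ i, s k i ≤ s l i + Fintype.card ι) ∧
      ∀ k ∈ C, ∀ i, i ∉ C → s k i ≤ Fintype.card ι := by
  classical
  let T := ↥(Finset.piAntidiag (Finset.univ : Finset ι) N)
  have hT : ∀ t : ι → ℕ, t ∈ Finset.piAntidiag Finset.univ N ↔ ∑ i, t i = N := fun t => by
    simp [Finset.mem_piAntidiag]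
  obtain ⟨i₀⟩ := ‹Nonempty ι›
  have : Nonempty ι := ⟨i₀⟩
  have : Nonempty T := ⟨⟨Pi.single i₀ N, by rw [hT]; simp⟩⟩
  let e : T ⊕ ι → ℕ := fun x => Fintype.equivFin (T ⊕ ι) x
  have he : Function.Injective e :=
    Fin.val_injective.comp (Fintype.equivFin (T ⊕ ι)).injective
  -- On points the values lie in `[1, N + 1]`, strictly between the two slack values `0` and `N +
  -- 2`. The enumeration `e` breaks ties to make each ranking injective.
  let v : ι → T ⊕ ι → ℕ := fun k =>
    Sum.elim (fun t => t.1 k + 1) (fun j => if j = k then 0 else N + 2)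
  let f : ι → T ⊕ ι → ℕ ×ₗ ℕ := fun k x => toLex (v k x, e x)
  have hflt : ∀ k x y, v k x < v k y → f k x < f k y := fun k x y h =>
    Prod.Lex.toLex_lt_toLex.2 (Or.inl h)
  have hfle : ∀ k x y, f k x ≤ f k y → v k x ≤ v k y := fun k x y h => by
    by_contra hv
    exact absurd (hflt k y x (not_le.1 hv)) (not_lt.2 h)
  have hle : ∀ (t : T) k, t.1 k ≤ N := fun t k =>
    (Finset.single_le_sum (f := t.1) (fun _ _ => Nat.zero_le _) (Finset.mem_univ k)).trans_eq
      ((hT t.1).1 t.2)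
  obtain ⟨S, hS, hcol⟩ := exists_isDominant_colourful (f := f)
    (fun k x y h => he (congrArg (fun z => (ofLex z).2) h))
    (fun i t => hflt _ _ _ (by simp [v]))
    (fun i j t hij => hflt _ _ _ (by
      have := hle t i
      simp only [v, Sum.elim_inl, Sum.elim_inr, if_neg hij.symm]
      omega)) (fun t => c t.1)
  have hex : ∀ k, ∃ t : T, .inr k ∉ S → .inl t ∈ S ∧ c t.1 = k := by
    intro k
    have hk : k ∈ S.image (Sum.elim (fun t : T => c t.1) id) := by
      rw [hcol]
      exact Finset.mem_univ k
    obtain ⟨x, hx, hxk⟩ := Finset.mem_image.1 hk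
    rcases x with t | j
    · exact ⟨t, fun _ => ⟨hx, hxk⟩⟩
    · simp only [Sum.elim_inr, id] at hxk
      exact ⟨Classical.arbitrary T, fun h => absurd (hxk ▸ hx) h⟩
  choose s hs using hex
  set C : Finset ι := Finset.univ.filter fun k => Sum.inr k ∉ S
  have hCmem : ∀ k, k ∈ C ↔ Sum.inr k ∉ S := fun k => by simp [C]
  -- Dominance restricted to points: a ranking `i` with `inr i ∈ S` cannot be the witness, since
  -- that slack has value `0`.
  have hdom : ∀ t : ι → ℕ, ∑ i, t i = N → ∃ i ∈ C, ∀ k ∈ C, t i ≤ (s k).1 i := by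
    intro t ht
    obtain ⟨i, hi⟩ := hS (.inl ⟨t, (hT t).2 ht⟩)
    refine ⟨i, (hCmem i).2 fun hiS => ?_, fun k hk => ?_⟩
    · have := hfle _ _ _ (hi _ hiS)
      simp [v] at this
    · have := hfle _ _ _ (hi _ (hs k ((hCmem k).1 hk)).1)
      simpa [v] using this
  have hCne : C.Nonempty := by
    obtain ⟨i, hi, -⟩ := hdom _ ((hT _).1 (Classical.arbitrary T).2)
    exact ⟨i, hi⟩
  have hmin : ∀ i, ∃ k ∈ C, ∀ l ∈ C, (s k).1 i ≤ (s l).1 i := fun i =>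
    Finset.exists_min_image C (fun k => (s k).1 i) hCne
  choose κ hκC hκ using hmin
  set m : ι → ℕ := fun i => (s (κ i)).1 i
  -- Otherwise some grid point exceeds the minima `m` in every coordinate of `C`, the unused mass
  -- going to coordinate `j`, against `hdom`. So `m` almost exhausts the total `N`, which leaves
  -- each `s k` little room above `m` on `C` or above `0` outside it.
  have hbig : N < ∑ i ∈ C, (m i + 1) := by
    by_contra hlt
    push Not at hlt
    obtain ⟨j, hj⟩ := hCne
    let t : ι → ℕ := fun i =>
      (if i ∈ C then m i + 1 else 0) + if i = j then N - ∑ i ∈ C, (m i + 1) else 0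
    have ht : ∑ i, t i = N := by
      simp only [t, Finset.sum_add_distrib, Finset.sum_ite_eq', Finset.mem_univ, if_true,
        Finset.sum_ite_mem, Finset.univ_inter] at hlt ⊢
      omega
    obtain ⟨i, hi, h⟩ := hdom t ht
    have h1 := h (κ i) (hκC i)
    have h2 : m i + 1 ≤ t i := by simp [t, hi]
    have h3 : m i = (s (κ i)).1 i := rfl
    omega
  have hbig' : N < ∑ i ∈ C, m i + Fintype.card ι := by
    rw [Finset.sum_add_distrib] at hbig
    have := Finset.card_le_univ C
    simp only [Finset.sum_const, smul_eq_mul, mul_one] at hbig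
    omega
  have hout : ∀ k ∈ C, ∀ i, i ∉ C → (s k).1 i ≤ Fintype.card ι := by
    intro k hk i hi
    have h1 : ∑ l ∈ insert i C, (s k).1 l ≤ N :=
      (Finset.sum_le_sum_of_subset (Finset.subset_univ _)).trans_eq ((hT (s k).1).1 (s k).2)
    rw [Finset.sum_insert hi] at h1
    have h2 : ∑ l ∈ C, m l ≤ ∑ l ∈ C, (s k).1 l := Finset.sum_le_sum fun l _ => hκ l k hk
    omega
  refine ⟨C, fun k => (s k).1, hCne,
    fun k hk => ⟨(hT _).1 (s k).2, (hs k ((hCmem k).1 hk)).2⟩, fun k hk l hl i => ?_, hout⟩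
  by_cases hi : i ∈ C
  · have h1 : ∑ l ∈ C, (s k).1 l ≤ N :=
      (Finset.sum_le_sum_of_subset (Finset.subset_univ _)).trans_eq ((hT (s k).1).1 (s k).2)
    rw [← Finset.add_sum_erase _ _ hi] at h1 hbig'
    have h2 : ∑ l ∈ C.erase i, m l ≤ ∑ l ∈ C.erase i, (s k).1 l :=
      Finset.sum_le_sum fun l _ => hκ l k hk
    have h3 : m i ≤ (s l).1 i := hκ i l hl
    show (s k).1 i ≤ (s l).1 i + _
    omega
  · exact (hout k hk i hi).trans (Nat.le_add_left _ _)

/-- Brouwer's fixed-point theorem for the standard simplex. -/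
theorem exists_fixedPoint_stdSimplex {ι : Type*} [Fintype ι] [Nonempty ι]
    {F : (ι → ℝ) → ι → ℝ} (hF : ContinuousOn F (stdSimplex ℝ ι))
    (hmaps : Set.MapsTo F (stdSimplex ℝ ι) (stdSimplex ℝ ι)) :
    ∃ z ∈ stdSimplex ℝ ι, F z = z := by
  classical
  set Δ := stdSimplex ℝ ι
  have hcpt : IsCompact Δ := isCompact_stdSimplex ℝ ι
  have hcolour : ∀ x : ι → ℝ, ∃ k, x ∈ Δ → x k ≤ F x k := by
    intro x
    by_cases hx : x ∈ Δ
    · obtain ⟨k, -, hk⟩ := Finset.exists_le_of_sum_le (s := (Finset.univ : Finset ι))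
        Finset.univ_nonempty (f := x) (g := F x) (by rw [hx.2, (hmaps hx).2])
      exact ⟨k, fun _ => hk⟩
    · exact ⟨Classical.arbitrary ι, fun h => absurd h hx⟩
  choose c hc using hcolour
  have hcoarse : ∀ ε > 0, ∃ z ∈ Δ, ∀ k, ∃ y ∈ Δ, dist y z ≤ ε ∧ y k ≤ F y k + ε := by
    intro ε hε
    obtain ⟨N, hN⟩ := exists_nat_gt ((Fintype.card ι : ℝ) / ε)
    have hN0 : (0 : ℝ) < N := lt_of_le_of_lt (by positivity) hN
    have hNε : (Fintype.card ι : ℝ) / N ≤ ε := by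
      rw [div_lt_iff₀ hε] at hN
      rw [div_le_iff₀ hN0]
      linarith
    let sc : (ι → ℕ) → ι → ℝ := fun t i => (t i : ℝ) / N
    obtain ⟨C, s, ⟨l, hl⟩, hsC, hclose, hout⟩ :=
      exists_colourful_grid_points N fun t => c (sc t)
    have hmem : ∀ k ∈ C, sc (s k) ∈ Δ := by
      intro k hk
      refine ⟨fun i => by positivity, ?_⟩
      simp only [sc]
      rw [← Finset.sum_div, ← Nat.cast_sum, (hsC k hk).1, div_self hN0.ne']
    have hdiff : ∀ k ∈ C, ∀ l ∈ C, ∀ i, sc (s k) i - sc (s l) i ≤ ε := by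
      intro k hk l hl i
      refine le_trans ?_ hNε
      simp only [sc]
      rw [← sub_div, div_le_div_iff_of_pos_right hN0, sub_le_iff_le_add']
      exact_mod_cast hclose k hk l hl i
    refine ⟨sc (s l), hmem l hl, fun k => ?_⟩
    by_cases hk : k ∈ C
    · refine ⟨sc (s k), hmem k hk, ?_, ?_⟩
      · rw [dist_pi_le_iff hε.le]
        intro i
        rw [Real.dist_eq, abs_le]
        constructor <;> linarith [hdiff k hk l hl i, hdiff l hl k hk i]
      · have := hc (sc (s k)) (hmem k hk)
        rw [(hsC k hk).2] at this
        linarith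
    -- A colour outside `C` needs no point of its own: coordinate `k` is already at most `ε`, and
    -- `F` is nonnegative.
    · refine ⟨sc (s l), hmem l hl, by simpa using hε.le, ?_⟩
      have h1 : sc (s l) k ≤ ε := by
        refine le_trans ?_ hNε
        simp only [sc]
        rw [div_le_div_iff_of_pos_right hN0]
        exact_mod_cast hout l hl k hk
      have h2 := (hmaps (hmem l hl)).1 k
      linarith
  have hfine : ∀ ε > 0, ∃ z ∈ Δ, ∀ k, z k - F z k ≤ ε := by
    intro ε hε
    -- Three errors of `ε / 3`: moving from `z k` to `y k`, the colour inequality at `y`, and moving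
    -- from `F y k` to `F z k`.
    obtain ⟨δ, hδ, h⟩ := Metric.uniformContinuousOn_iff.1
      (hcpt.uniformContinuousOn_of_continuous hF) (ε / 3) (by positivity)
    obtain ⟨z, hz, hzk⟩ := hcoarse (min (δ / 2) (ε / 3)) (by positivity)
    refine ⟨z, hz, fun k => ?_⟩
    obtain ⟨y, hy, hyz, hyk⟩ := hzk k
    have h1 := h y hy z hz (by linarith [min_le_left (δ / 2) (ε / 3)])
    have h2 := (dist_le_pi_dist (F y) (F z) k).trans h1.le
    have h3 := (dist_le_pi_dist y z k).trans hyz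
    rw [Real.dist_eq] at h2 h3
    have := min_le_right (δ / 2) (ε / 3)
    linarith [(abs_le.1 h2).2, (abs_le.1 h3).1]
  have hne : Δ.Nonempty := (hfine 1 one_pos).imp fun z hz => hz.1
  -- Compactness turns approximate solutions into an exact one: the total excess attains its
  -- minimum, which must be zero. Then `z ≤ F z` coordinatewise, and equal sums force equality.
  obtain ⟨z, hz, hmin⟩ := hcpt.exists_isMinOn hne
    (f := fun z => ∑ k, max 0 (z k - F z k)) (by fun_prop)
  have hzero : ∑ k, max 0 (z k - F z k) ≤ 0 := by
    refine le_of_forall_pos_le_add fun ε hε => ?_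
    have hcard : (0 : ℝ) < Fintype.card ι := by exact_mod_cast Fintype.card_pos
    obtain ⟨y, hy, hyk⟩ := hfine (ε / Fintype.card ι) (by positivity)
    calc ∑ k, max 0 (z k - F z k) ≤ ∑ k, max 0 (y k - F y k) := hmin hy
      _ ≤ ∑ _k : ι, ε / Fintype.card ι :=
        Finset.sum_le_sum fun k _ => max_le (by positivity) (hyk k)
      _ = 0 + ε := by
        rw [Finset.sum_const, Finset.card_univ, nsmul_eq_mul]
        field_simp
        ring
  have hle : ∀ k, z k ≤ F z k := by
    intro k
    have h1 := Finset.single_le_sum (f := fun k => max 0 (z k - F z k))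
      (fun _ _ => le_max_left _ _) (Finset.mem_univ k)
    have h2 := le_max_right 0 (z k - F z k)
    linarith
  refine ⟨z, hz, funext fun k => ?_⟩
  exact ((Finset.sum_eq_sum_iff_of_le fun i _ => hle i).1
    (by rw [hz.2, (hmaps hz).2]) k (Finset.mem_univ k)).symm

/-! ### Mixed payoffs and Nash's map -/

theorem joinProfile_self {I : Type*} {A : I → Type*} [DecidableEq I] (i : I) (x : A i)
    (y : OthersProfile A i) : joinProfile i x y i = x := by
  simp [joinProfile]

theorem joinProfile_of_ne {I : Type*} {A : I → Type*} [DecidableEq I] (i : I) (x : A i)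
    (y : OthersProfile A i) (j : {j : I // j ≠ i}) : joinProfile i x y j = y j := by
  simp [joinProfile, Equiv.piSplitAt, j.2]

section Nash

variable {I : Type*} {A : I → Type*} [Fintype I] [DecidableEq I]

/-- Probability that the players other than `i` play `y` under independent mixing. -/
def othersProb (α : ∀ i, A i → ℝ) (i : I) (y : OthersProfile A i) : ℝ :=
  ∏ j : {j : I // j ≠ i}, α j (y j)

theorem othersProb_update (α : ∀ i, A i → ℝ) (i : I) (β : A i → ℝ) (y : OthersProfile A i) :
    othersProb (Function.update α i β) i y = othersProb α i y :=
  Finset.prod_congr rfl fun j _ => by rw [Function.update_of_ne j.2]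

theorem prod_joinProfile (α : ∀ i, A i → ℝ) (i : I) (x : A i) (y : OthersProfile A i) :
    ∏ j, α j (joinProfile i x y j) = α i x * othersProb α i y := by
  rw [Fintype.prod_eq_mul_prod_subtype_ne _ i, joinProfile_self]
  simp only [othersProb, joinProfile_of_ne]

variable [∀ i, Fintype (A i)]

/-- Expected payoff of the pure action `x` of player `i` when the others mix according to `α`. -/
def actionPayoff (w : (∀ j, A j) → ℝ) (α : ∀ i, A i → ℝ) (i : I) (x : A i) : ℝ :=
  ∑ y : OthersProfile A i, othersProb α i y * w (joinProfile i x y)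

theorem sum_profile_eq (i : I) (F : (∀ j, A j) → ℝ) :
    ∑ a, F a = ∑ x, ∑ y : OthersProfile A i, F (joinProfile i x y) := by
  rw [← Fintype.sum_prod_type' (f := fun x y => F (joinProfile i x y))]
  exact Fintype.sum_equiv (Equiv.piSplitAt i A) _ _ fun a =>
    congrArg F ((Equiv.piSplitAt i A).symm_apply_apply a).symm

theorem mixedPayoff_eq (w : (∀ j, A j) → ℝ) (α : ∀ i, A i → ℝ) (i : I) :
    mixedPayoff w α = ∑ x, α i x * actionPayoff w α i x := by
  rw [mixedPayoff, sum_profile_eq i]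
  refine Finset.sum_congr rfl fun x _ => ?_
  rw [actionPayoff, Finset.mul_sum]
  exact Finset.sum_congr rfl fun y _ => by rw [prod_joinProfile, mul_assoc]

theorem mixedPayoff_update (w : (∀ j, A j) → ℝ) (α : ∀ i, A i → ℝ) (i : I) (β : A i → ℝ) :
    mixedPayoff w (Function.update α i β) = ∑ x, β x * actionPayoff w α i x := by
  rw [mixedPayoff_eq w _ i]
  refine Finset.sum_congr rfl fun x _ => ?_
  simp only [actionPayoff, othersProb_update, Function.update_self]

theorem sum_othersProb {α : ∀ i, A i → ℝ} (hα : ∀ i, α i ∈ stdSimplex ℝ (A i)) (i : I) :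
    ∑ y : OthersProfile A i, othersProb α i y = 1 := by
  have := Fintype.prod_sum fun (j : {j : I // j ≠ i}) (x : A j) => α j x
  simp only [othersProb]
  rw [← this]
  exact Finset.prod_eq_one fun j _ => (hα j).2

/-- The payoff is linear in a player's own strategy, so a mixed deviation is an average of pure ones
and testing the latter suffices. -/
theorem isNashEquilibrium_iff {w : ∀ _ : I, (∀ j, A j) → ℝ} {α : ∀ i, A i → ℝ} :
    IsNashEquilibrium w α ↔ (∀ i, α i ∈ stdSimplex ℝ (A i)) ∧
      ∀ i x, actionPayoff (w i) α i x ≤ mixedPayoff (w i) α := by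
  classical
  refine and_congr_right fun hα => forall_congr' fun i => ⟨fun h x => ?_, fun h β hβ => ?_⟩
  · have := h _ (single_mem_stdSimplex ℝ x)
    rw [mixedPayoff_update] at this
    simpa [Pi.single_apply] using this
  · rw [mixedPayoff_update]
    calc ∑ x, β x * actionPayoff (w i) α i x ≤ ∑ x, β x * mixedPayoff (w i) α :=
          Finset.sum_le_sum fun x _ => mul_le_mul_of_nonneg_left (h x) (hβ.1 x)
      _ = mixedPayoff (w i) α := by rw [← Finset.sum_mul, hβ.2, one_mul]

/-- Actions played with positive probability in a Nash equilibrium are optimal. -/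
theorem IsNashEquilibrium.actionPayoff_le {w : ∀ _ : I, (∀ j, A j) → ℝ} {α : ∀ i, A i → ℝ}
    (h : IsNashEquilibrium w α) {i : I} {x : A i} (hx : 0 < α i x) (x' : A i) :
    actionPayoff (w i) α i x' ≤ actionPayoff (w i) α i x := by
  obtain ⟨hα, hle⟩ := isNashEquilibrium_iff.1 h
  refine (hle i x').trans ?_
  by_contra hlt
  push Not at hlt
  have : mixedPayoff (w i) α < mixedPayoff (w i) α := by
    calc mixedPayoff (w i) α = ∑ x, α i x * actionPayoff (w i) α i x := mixedPayoff_eq _ _ _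
      _ < ∑ x, α i x * mixedPayoff (w i) α :=
        Finset.sum_lt_sum (fun z _ => mul_le_mul_of_nonneg_left (hle i z) ((hα i).1 z))
          ⟨x, Finset.mem_univ _, mul_lt_mul_of_pos_left hlt hx⟩
      _ = mixedPayoff (w i) α := by rw [← Finset.sum_mul, (hα i).2, one_mul]
  exact lt_irrefl _ this

theorem continuous_actionPayoff (w : (∀ j, A j) → ℝ) (i : I) (x : A i) :
    Continuous fun α : ∀ i, A i → ℝ => actionPayoff w α i x := by
  unfold actionPayoff othersProb
  fun_prop

theorem continuous_mixedPayoff (w : (∀ j, A j) → ℝ) :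
    Continuous fun α : ∀ i, A i → ℝ => mixedPayoff w α := by
  unfold mixedPayoff
  fun_prop

/-- The positive part of the gain from deviating to the pure action `x`. -/
def deviationGain (w : ∀ _ : I, (∀ j, A j) → ℝ) (α : ∀ i, A i → ℝ) (i : I) (x : A i) : ℝ :=
  max 0 (actionPayoff (w i) α i x - mixedPayoff (w i) α)

/-- Nash's map, whose fixed points are the equilibria. -/
noncomputable def nashMap (w : ∀ _ : I, (∀ j, A j) → ℝ) (α : ∀ i, A i → ℝ) (i : I) (x : A i) : ℝ :=
  (α i x + deviationGain w α i x) / (1 + ∑ x', deviationGain w α i x')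

theorem deviationGain_nonneg (w : ∀ _ : I, (∀ j, A j) → ℝ) (α : ∀ i, A i → ℝ) (i : I) (x : A i) :
    0 ≤ deviationGain w α i x := le_max_left _ _

theorem one_add_sum_deviationGain_pos (w : ∀ _ : I, (∀ j, A j) → ℝ) (α : ∀ i, A i → ℝ) (i : I) :
    0 < 1 + ∑ x, deviationGain w α i x :=
  add_pos_of_pos_of_nonneg one_pos (Finset.sum_nonneg fun x _ => deviationGain_nonneg w α i x)

theorem continuous_nashMap (w : ∀ _ : I, (∀ j, A j) → ℝ) : Continuous (nashMap w) := by
  have hg : ∀ i x, Continuous fun α => deviationGain w α i x := fun i x =>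
    continuous_const.max ((continuous_actionPayoff _ i x).sub (continuous_mixedPayoff _))
  refine continuous_pi fun i => continuous_pi fun x => ?_
  refine Continuous.div (by fun_prop) (by fun_prop) fun α =>
    (one_add_sum_deviationGain_pos w α i).ne'

theorem nashMap_mem {w : ∀ _ : I, (∀ j, A j) → ℝ} {α : ∀ i, A i → ℝ}
    (hα : ∀ i, α i ∈ stdSimplex ℝ (A i)) (i : I) : nashMap w α i ∈ stdSimplex ℝ (A i) := by
  refine ⟨fun x => div_nonneg (add_nonneg ((hα i).1 x) (deviationGain_nonneg w α i x))
    (one_add_sum_deviationGain_pos w α i).le, ?_⟩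
  simp only [nashMap]
  rw [← Finset.sum_div, Finset.sum_add_distrib, (hα i).2,
    div_self (one_add_sum_deviationGain_pos w α i).ne']

/-- At a fixed point each gain is `α i x` times the total gain `s`. If `s > 0`, every action in use
would beat the average payoff, which is impossible. -/
theorem isNashEquilibrium_of_nashMap_eq {w : ∀ _ : I, (∀ j, A j) → ℝ} {α : ∀ i, A i → ℝ}
    (hα : ∀ i, α i ∈ stdSimplex ℝ (A i)) (hfix : nashMap w α = α) : IsNashEquilibrium w α := by
  refine isNashEquilibrium_iff.2 ⟨hα, fun i x => ?_⟩
  set s := ∑ x, deviationGain w α i x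
  have hs0 : 0 ≤ s := Finset.sum_nonneg fun x _ => deviationGain_nonneg w α i x
  have hfix' : ∀ x, α i x * s = deviationGain w α i x := by
    intro x
    have h := congrFun (congrFun hfix i) x
    rw [nashMap, div_eq_iff (one_add_sum_deviationGain_pos w α i).ne'] at h
    linarith
  have hgain : ∀ x, actionPayoff (w i) α i x - mixedPayoff (w i) α ≤ deviationGain w α i x :=
    fun x => le_max_right _ _
  rcases hs0.eq_or_lt with h0 | hpos
  · have := hfix' x
    rw [← h0, mul_zero] at this
    linarith [hgain x]
  exfalso
  have hzero : ∑ x, α i x * (actionPayoff (w i) α i x - mixedPayoff (w i) α) = 0 := by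
    simp only [mul_sub]
    rw [Finset.sum_sub_distrib, ← mixedPayoff_eq, ← Finset.sum_mul, (hα i).2]
    ring
  have hterm : ∀ x, α i x * (actionPayoff (w i) α i x - mixedPayoff (w i) α) =
      α i x * deviationGain w α i x := by
    intro x
    rcases ((hα i).1 x).eq_or_lt with h | h
    · rw [← h]; simp
    · have hd : 0 < deviationGain w α i x := by rw [← hfix' x]; positivity
      congr 1
      rw [deviationGain] at hd ⊢
      rcases lt_max_iff.1 hd with hd | hd
      · exact absurd hd (lt_irrefl _)
      · rw [max_eq_right hd.le]
  -- Since the gain is `α i x * s`, this is a vanishing sum of `s` times squares, which kills all of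
  -- `α i`.
  have hsq : ∑ x, α i x * deviationGain w α i x = 0 := by
    rw [← hzero]
    exact Finset.sum_congr rfl fun x _ => (hterm x).symm
  have hall := (Finset.sum_eq_zero_iff_of_nonneg fun x _ =>
    mul_nonneg ((hα i).1 x) (deviationGain_nonneg w α i x)).1 hsq
  have : ∀ x, α i x = 0 := by
    intro x
    have h := hall x (Finset.mem_univ x)
    rw [← hfix' x] at h
    rcases mul_eq_zero.1 h with h | h
    · exact h
    · exact (mul_eq_zero.1 h).resolve_right hpos.ne'
  have h1 := (hα i).2
  simp [this] at h1

/-! ### Nash's theorem from Brouwer on a single simplex -/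

/-- A retraction of the nonnegative orthant onto the standard simplex. -/
noncomputable def simplexRetract {ι : Type*} [Fintype ι] (z : ι → ℝ) (x : ι) : ℝ :=
  (z x + max 0 (1 - ∑ x', z x') / Fintype.card ι) / max 1 (∑ x', z x')

theorem continuous_simplexRetract {ι : Type*} [Fintype ι] :
    Continuous (simplexRetract : (ι → ℝ) → ι → ℝ) := by
  refine continuous_pi fun x => Continuous.div ?_ (by fun_prop) fun z =>
    (lt_of_lt_of_le one_pos (le_max_left _ _)).ne'
  exact (continuous_apply x).add (Continuous.div_const (by fun_prop) _)

/-- Missing mass is spread evenly and excess mass is normalised away; at most one correction is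
active. Plain normalisation would fail at the origin. -/
theorem simplexRetract_mem {ι : Type*} [Fintype ι] [Nonempty ι] {z : ι → ℝ} (hz : ∀ x, 0 ≤ z x) :
    simplexRetract z ∈ stdSimplex ℝ ι := by
  have hcard : (Fintype.card ι : ℝ) ≠ 0 := by exact_mod_cast Fintype.card_ne_zero
  have hpos : 0 < max 1 (∑ x, z x) := lt_of_lt_of_le one_pos (le_max_left _ _)
  refine ⟨fun x => div_nonneg (add_nonneg (hz x) (by positivity)) hpos.le, ?_⟩
  simp only [simplexRetract]
  rw [← Finset.sum_div, Finset.sum_add_distrib, Finset.sum_const, Finset.card_univ, nsmul_eq_mul,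
    mul_div_cancel₀ _ hcard, div_eq_one_iff_eq hpos.ne']
  rcases le_total 1 (∑ x, z x) with h | h
  · rw [max_eq_right h, max_eq_left (by linarith)]; ring
  · rw [max_eq_left h, max_eq_right (by linarith)]; ring

theorem simplexRetract_eq {ι : Type*} [Fintype ι] {z : ι → ℝ} (hz : ∑ x, z x = 1) :
    simplexRetract z = z := by
  ext x
  simp [simplexRetract, hz]

/-- Nash's theorem: every finite game has a mixed-strategy equilibrium. -/
theorem exists_isNashEquilibrium [∀ i, Nonempty (A i)] (w : ∀ _ : I, (∀ j, A j) → ℝ) :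
    ∃ α : ∀ i, A i → ℝ, IsNashEquilibrium w α := by
  rcases isEmpty_or_nonempty I with hI | hI
  · exact ⟨fun i => hI.elim i, fun i => hI.elim i, fun i => hI.elim i⟩
  have hn : (0 : ℝ) < Fintype.card I := by exact_mod_cast Fintype.card_pos
  -- A strategy profile is encoded as one distribution on the disjoint union of the action sets,
  -- each player's block having mass `1 / card I`. Blocks of a general `z` may have another mass, so
  -- `r` rescales and then retracts.
  let r : ((Σ i, A i) → ℝ) → ∀ i, A i → ℝ := fun z i =>
    simplexRetract fun x => Fintype.card I * z ⟨i, x⟩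
  let F : ((Σ i, A i) → ℝ) → (Σ i, A i) → ℝ := fun z j =>
    nashMap w (r z) j.1 j.2 / Fintype.card I
  have hr : Continuous r := continuous_pi fun i =>
    continuous_simplexRetract.comp (by fun_prop)
  have hF : Continuous F := continuous_pi fun j => by
    have := (continuous_nashMap w).comp hr
    have h2 : Continuous fun z => nashMap w (r z) j.1 j.2 :=
      (continuous_apply j.2).comp ((continuous_apply j.1).comp this)
    exact h2.div_const _
  have hrmem : ∀ z ∈ stdSimplex ℝ (Σ i, A i), ∀ i, r z i ∈ stdSimplex ℝ (A i) := fun z hz i =>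
    simplexRetract_mem fun x => mul_nonneg hn.le (hz.1 _)
  have : Nonempty (Σ i, A i) := hI.elim fun i => (‹∀ i, Nonempty (A i)› i).elim fun x => ⟨⟨i, x⟩⟩
  obtain ⟨z, hz, hfix⟩ := exists_fixedPoint_stdSimplex (F := F) hF.continuousOn (by
    intro z hz
    have h := fun i => nashMap_mem (w := w) (hrmem z hz) i
    refine ⟨fun j => div_nonneg ((h j.1).1 j.2) hn.le, ?_⟩
    rw [Fintype.sum_sigma]
    simp only [F]
    simp only [← Finset.sum_div, (h _).2]
    simp [hn.ne'])
  have hmem := hrmem z hz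
  have hzr : ∀ i x, nashMap w (r z) i x = Fintype.card I * z ⟨i, x⟩ := by
    intro i x
    have := congrFun hfix ⟨i, x⟩
    simp only [F] at this
    rw [div_eq_iff hn.ne'] at this
    rw [this, mul_comm]
  refine ⟨r z, isNashEquilibrium_of_nashMap_eq hmem ?_⟩
  funext i
  -- At the fixed point the rescaled block is a value of Nash's map, hence already in the simplex,
  -- and the retraction does nothing to it.
  have h1 : (fun x => Fintype.card I * z ⟨i, x⟩) = nashMap w (r z) i :=
    funext fun x => (hzr i x).symm
  show _ = simplexRetract fun x => Fintype.card I * z ⟨i, x⟩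
  rw [h1, simplexRetract_eq (nashMap_mem hmem i).2]

end Nash

/-! ### Outcomes induced by independent mixing -/

section InducedOutcome

variable {I Θ : Type*} {A : I → Type*} [Fintype I] [DecidableEq I] [Fintype Θ]
  [∀ i, Fintype (A i)] (G : BaseGame I Θ A)

theorem inducedOutcome_joinProfile (α : ∀ i, A i → ℝ) (i : I) (x : A i) (y : OthersProfile A i)
    (θ : Θ) : G.inducedOutcome α (joinProfile i x y, θ) =
      α i x * (othersProb α i y * G.prior θ) := by
  simp only [BaseGame.inducedOutcome, prod_joinProfile]
  ring

theorem actionProb_inducedOutcome {α : ∀ i, A i → ℝ} (hα : ∀ i, α i ∈ stdSimplex ℝ (A i)) (i : I)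
    (x : A i) : actionProb (G.inducedOutcome α) i x = α i x := by
  simp only [actionProb, inducedOutcome_joinProfile, ← Finset.mul_sum, G.prior_mem.2, mul_one,
    sum_othersProb hα]

/-- By independence `α i x` factors out and cancels, so the right-hand side does not involve `x`.
This is what trivialises separation. -/
theorem condBelief_inducedOutcome {α : ∀ i, A i → ℝ} (hα : ∀ i, α i ∈ stdSimplex ℝ (A i)) {i : I}
    {x : A i} (hx : x ∈ actionSupp (G.inducedOutcome α) i) :
    condBelief (G.inducedOutcome α) i x = fun yθ => othersProb α i yθ.1 * G.prior yθ.2 := by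
  have hx0 : 0 < α i x := by rw [← actionProb_inducedOutcome G hα]; exact hx
  ext ⟨y, θ⟩
  simp only [condBelief, actionProb_inducedOutcome G hα, inducedOutcome_joinProfile]
  exact mul_div_cancel_left₀ _ hx0.ne'

theorem isOutcome_inducedOutcome {α : ∀ i, A i → ℝ} (hα : ∀ i, α i ∈ stdSimplex ℝ (A i)) :
    G.IsOutcome (G.inducedOutcome α) := by
  have hmarg : ∀ θ, ∑ a, G.inducedOutcome α (a, θ) = G.prior θ := fun θ => by
    simp only [BaseGame.inducedOutcome, ← Finset.mul_sum, ← Fintype.prod_sum, (hα _).2,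
      Finset.prod_const_one, mul_one]
  refine ⟨⟨fun aθ => mul_nonneg (G.prior_mem.1 _) (Finset.prod_nonneg fun j _ => (hα j).1 _), ?_⟩,
    hmarg⟩
  rw [Fintype.sum_prod_type_right]
  simp only [hmarg, G.prior_mem.2]

/-- The obedience sum is `α i x` times the payoff advantage of `x` over `x'`: either the factor
vanishes or `x` is played and hence optimal. -/
theorem obedient_inducedOutcome {α : ∀ i, A i → ℝ}
    (h : IsNashEquilibrium G.averagedPayoff α) : G.Obedient (G.inducedOutcome α) := by
  intro i x x'
  have key : ∑ y : OthersProfile A i, ∑ θ,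
      (G.u i (joinProfile i x y) θ - G.u i (joinProfile i x' y) θ) *
        G.inducedOutcome α (joinProfile i x y, θ) =
      α i x * (actionPayoff (G.averagedPayoff i) α i x -
        actionPayoff (G.averagedPayoff i) α i x') := by
    simp only [actionPayoff, BaseGame.averagedPayoff, inducedOutcome_joinProfile]
    rw [← Finset.sum_sub_distrib, Finset.mul_sum]
    refine Finset.sum_congr rfl fun y _ => ?_
    rw [← mul_sub, ← Finset.sum_sub_distrib, Finset.mul_sum, Finset.mul_sum]
    exact Finset.sum_congr rfl fun θ _ => by ring
  rw [key]
  rcases ((h.1 i).1 x).eq_or_lt with h0 | hpos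
  · rw [← h0, zero_mul]
  · exact mul_nonneg hpos.le (sub_nonneg.2 (h.actionPayoff_le hpos x'))

end InducedOutcome

theorem corollary1 {I Θ : Type*} {A : I → Type*} [Fintype I] [DecidableEq I] [Fintype Θ]
    [∀ i, Fintype (A i)] [∀ i, Nonempty (A i)] (G : BaseGame I Θ A) :
    (∃ p : (∀ j, A j) × Θ → ℝ, G.IsSeparatedBCE p) ∧
      ∀ α : ∀ i, A i → ℝ, IsNashEquilibrium G.averagedPayoff α →
        G.IsSeparatedBCE (G.inducedOutcome α) ∧
          ∀ i, ∀ x ∈ actionSupp (G.inducedOutcome α) i,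
            ∀ x' ∈ actionSupp (G.inducedOutcome α) i,
              condBelief (G.inducedOutcome α) i x = condBelief (G.inducedOutcome α) i x' := by
  have main : ∀ α : ∀ i, A i → ℝ, IsNashEquilibrium G.averagedPayoff α →
        G.IsSeparatedBCE (G.inducedOutcome α) ∧
          ∀ i, ∀ x ∈ actionSupp (G.inducedOutcome α) i,
            ∀ x' ∈ actionSupp (G.inducedOutcome α) i,
              condBelief (G.inducedOutcome α) i x = condBelief (G.inducedOutcome α) i x' := by
    intro α h
    have heq : ∀ i, ∀ x ∈ actionSupp (G.inducedOutcome α) i,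
        ∀ x' ∈ actionSupp (G.inducedOutcome α) i,
          condBelief (G.inducedOutcome α) i x = condBelief (G.inducedOutcome α) i x' :=
      fun i x hx x' hx' => by
        rw [condBelief_inducedOutcome G h.1 hx, condBelief_inducedOutcome G h.1 hx']
    exact ⟨⟨⟨isOutcome_inducedOutcome G h.1, obedient_inducedOutcome G h⟩,
      fun i x hx x' hx' hne => absurd (heq i x hx x' hx') hne⟩, heq⟩
  obtain ⟨α, hα⟩ := exists_isNashEquilibrium G.averagedPayoff
  exact ⟨⟨_, (main α hα).1⟩, main⟩
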